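/- Let $S_3$ be the graph on the vertices $a,b,c,d,e,v$ with edges $ab,ac,bc,bd,bv,cv,dv,ce,ev$. Unfolding. Let $G$ be a graph, $v$ a vertex of $G$, and $X,Y$ sets of vertices such that $X\cup Y=N_G(v)$ and no edge connects $X\setminus Y$ and $Y\setminus X$. To unfold $v$ (with respect to $X,Y$) is to delete $v$, add two new vertices $x$ and $y$ whose neighbourhoods are $X$ and $Y$ respectively, and then add a further vertex $z$ adjacent only to $x$ and $y$. Box-perfect graphs. A finite graph is perfect if each of its induced subgraphs has chromatic number equal to its clique number. A rational system $Ax\le b$ is totally dual integral (TDI) if $\min\{b^\top y: A^\top y=w,\ y\ge \mathbf 0\}$ has an integer optimal solution for every integer vector $w$ for which this optimum is finite. It is box-TDI if the system $Ax\le b,\ \ell\le x\le u$ is TDI for all rational vectors $\ell,u$. A finite graph is box-perfect if the system $$x(C)\le 1\ \text{ for all cliques } C,\qquad x\ge \mathbf 0$$ is box-TDI. The class $\mathcal R$. A matrix is minimally non-TU if it is not totally unimodular but all its proper submatrices are. Take a bipartite graph $B=(U,V,E)$ whose biadjacency matrix is minimally non-TU, and a set $F$ of edges between vertices of $V$ such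 that in $B'=(U\cup V,E\cup F)$ the neighbourhood $N_{B'}(u)$ is a clique for all $u\in U$. If there is $u\in U$ with $N_{B'}(u)=V$, then $B'\setminus\{u\}$ is in $\mathcal R$; otherwise $B'$ is in $\mathcal R$. The class $\mathcal R$ consists of all graphs isomorphic to a graph obtained in this way. Proposition. Let $X=\{b,c,e\}$ and $Y=\{b,c,d\}$. Then $X\cup Y=N_{S_3}(v)$ and no edge of $S_3$ connects $X\setminus Y$ and $Y\setminus X$, and the graph $G^v$ obtained from $S_3$ by unfolding $v$ with respect to $X$ and $Y$ is perfect but not box-perfect, and no induced subgraph of $G^v$ belongs to $\mathcal R$. Consequently the conjecture of Ding, Zang and Zhao, that a perfect graph is box-perfect if and only if it contains no graph from $\mathcal R$ as an induced subgraph, is false. -/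

import Mathlib

/-! ### Totally dual integral and box-totally dual integral systems -/

namespace LinearSystem

variable {I J : Type*} [Fintype I]

/-- Real feasible solutions of the dual of `max {wᵀ x : A x ≤ b}`, i.e. of
`min {bᵀ y : Aᵀ y = w, y ≥ 0}`. -/
def IsDualFeasible (A : Matrix I J ℚ) (w : J → ℤ) (y : I → ℝ) : Prop :=
  (∀ i, 0 ≤ y i) ∧ ∀ j, ∑ i, (A i j : ℝ) * y i = (w j : ℝ)

/-- The dual objective `bᵀ y`. -/
def dualValue (b : I → ℚ) (y : I → ℝ) : ℝ := ∑ i, (b i : ℝ) * y i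

/-- The rational system `A x ≤ b` is totally dual integral: for every integer vector `w` for which
the optimum `min {bᵀ y : Aᵀ y = w, y ≥ 0}` is finite (the program is feasible and bounded), that
minimum is attained by an integer vector. -/
def IsTDI (A : Matrix I J ℚ) (b : I → ℚ) : Prop :=
  ∀ w : J → ℤ,
    (∃ y : I → ℝ, IsDualFeasible A w y) →
    BddBelow (dualValue b '' {y | IsDualFeasible A w y}) →
    ∃ y : I → ℤ, IsDualFeasible A w (fun i => (y i : ℝ)) ∧
      ∀ y' : I → ℝ, IsDualFeasible A w y' → dualValue b (fun i => (y i : ℝ)) ≤ dualValue b y'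

/-- The rational system `A x ≤ b` is box-totally dual integral: for all rational vectors `ℓ`, `u`,
the system `A x ≤ b`, `x ≤ u`, `-x ≤ -ℓ` is totally dual integral. -/
def IsBoxTDI [Fintype J] [DecidableEq J] (A : Matrix I J ℚ) (b : I → ℚ) : Prop :=
  ∀ ℓ u : J → ℚ,
    IsTDI (Matrix.fromRows A (Matrix.fromRows (1 : Matrix J J ℚ) (-1 : Matrix J J ℚ)))
      (Sum.elim b (Sum.elim u (-ℓ)))

end LinearSystem

/-! ### Perfect and box-perfect graphs -/

namespace SimpleGraph

/-- A (finite) graph is perfect if every induced subgraph has chromatic number equal to its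
clique number. -/
def IsPerfect {V : Type*} [Finite V] (G : SimpleGraph V) : Prop :=
  ∀ s : Set V, (G.induce s).chromaticNumber = ((G.induce s).cliqueNum : ℕ∞)

/-- The constraint matrix of the system `x(C) ≤ 1` for all cliques `C`, `-x ≤ 0`. -/
def cliqueSystemMatrix {V : Type*} [DecidableEq V] (G : SimpleGraph V) :
    Matrix ({C : Finset V // G.IsClique C} ⊕ V) V ℚ :=
  Matrix.fromRows (Matrix.of fun C v => if v ∈ C.1 then 1 else 0) (-1 : Matrix V V ℚ)

/-- The right-hand side of the system `x(C) ≤ 1` for all cliques `C`, `-x ≤ 0`. -/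
def cliqueSystemRhs {V : Type*} (G : SimpleGraph V) :
    {C : Finset V // G.IsClique C} ⊕ V → ℚ :=
  Sum.elim (fun _ => 1) (fun _ => 0)

/-- A graph is box-perfect if the system of the clique inequalities and the nonnegativity
constraints is box-TDI. -/
def IsBoxPerfect {V : Type*} [Fintype V] [DecidableEq V] (G : SimpleGraph V)
    [DecidableRel G.Adj] : Prop :=
  LinearSystem.IsBoxTDI G.cliqueSystemMatrix G.cliqueSystemRhs

end SimpleGraph

/-! ### The class `ℛ` -/

/-- A matrix is minimally non-TU if it is not totally unimodular but all its proper submatrices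
(obtained by deleting at least one row or column) are. -/
def Matrix.IsMinimallyNonTU {I J : Type*} (A : Matrix I J ℤ) : Prop :=
  ¬ A.IsTotallyUnimodular ∧
    ∀ (R : Set I) (C : Set J), (R ≠ Set.univ ∨ C ≠ Set.univ) →
      (A.submatrix (Subtype.val : R → I) (Subtype.val : C → J)).IsTotallyUnimodular

namespace SimpleGraph

open Classical in
/-- The biadjacency matrix of a graph on `U ⊕ V`: rows are indexed by `U`, columns by `V`. -/
noncomputable def biadjMatrix {U V : Type*} (B : SimpleGraph (U ⊕ V)) : Matrix U V ℤ :=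
  Matrix.of fun u v => if B.Adj (Sum.inl u) (Sum.inr v) then 1 else 0

/-- The graph obtained from `B` on `U ⊕ V` by adding the edges of `F` between vertices of `V`. -/
def addRightEdges {U V : Type*} (B : SimpleGraph (U ⊕ V)) (F : SimpleGraph V) :
    SimpleGraph (U ⊕ V) :=
  B ⊔ F.map Sum.inr

/-- Membership, up to isomorphism, in the class `ℛ`. Start with a bipartite graph `B` with colour
classes `U` and `V` whose biadjacency matrix is minimally non-TU, and add a set `F` of edges between
vertices of `V` such that in the resulting graph `B'` the neighbourhood of every `u ∈ U` is a
clique. If some `u ∈ U` has neighbourhood `V` in `B'`, then `B' ∖ {u}` is in `ℛ`; otherwise `B'` is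
in `ℛ`. -/
def InClassR {W : Type*} (H : SimpleGraph W) : Prop :=
  ∃ (m n : ℕ) (B : SimpleGraph (Fin m ⊕ Fin n)) (F : SimpleGraph (Fin n)),
    B.IsBipartiteWith (Set.range Sum.inl) (Set.range Sum.inr) ∧
    B.biadjMatrix.IsMinimallyNonTU ∧
    (∀ u : Fin m,
      (B.addRightEdges F).IsClique ((B.addRightEdges F).neighborSet (Sum.inl u))) ∧
    ((∃ u : Fin m, (B.addRightEdges F).neighborSet (Sum.inl u) = Set.range Sum.inr ∧
        Nonempty (H ≃g (B.addRightEdges F).induce {Sum.inl u}ᶜ)) ∨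
      ((∀ u : Fin m, (B.addRightEdges F).neighborSet (Sum.inl u) ≠ Set.range Sum.inr) ∧
        Nonempty (H ≃g B.addRightEdges F)))

/-- `G` contains a graph from `ℛ` as an induced subgraph. -/
def HasInducedR {W : Type*} (G : SimpleGraph W) : Prop :=
  ∃ s : Set W, (G.induce s).InClassR

/-! ### Unfolding a vertex -/

/-- The three new vertices created when a vertex is unfolded. -/
inductive UnfoldVertex
  | x | y | z
  deriving DecidableEq

instance : Fintype UnfoldVertex := ⟨{.x, .y, .z}, fun p => by cases p <;> simp⟩

/-- The condition on `X`, `Y` for unfolding `v`: `X ∪ Y = N(v)` and no edge connects `X ∖ Y` and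
`Y ∖ X`. -/
def CanUnfold {V : Type*} (G : SimpleGraph V) (v : V) (X Y : Set V) : Prop :=
  X ∪ Y = G.neighborSet v ∧ ∀ p ∈ X \ Y, ∀ q ∈ Y \ X, ¬ G.Adj p q

/-- The edges of the unfolded graph, each listed in one direction: the edges of `G` avoiding `v`,
`x` to `X`, `y` to `Y`, and `z` to `x` and `y`. -/
def unfoldRel {V : Type*} (G : SimpleGraph V) (v : V) (X Y : Set V) :
    {w : V // w ≠ v} ⊕ UnfoldVertex → {w : V // w ≠ v} ⊕ UnfoldVertex → Prop
  | .inl s, .inl t => G.Adj s t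
  | .inr .x, .inl t => t.1 ∈ X
  | .inr .y, .inl t => t.1 ∈ Y
  | .inr .z, .inr q => q = .x ∨ q = .y
  | _, _ => False

/-- Unfolding `v` in `G` with respect to `X` and `Y`: delete `v`, add `x` adjacent to `X` and `y`
adjacent to `Y`, and finally a vertex `z` adjacent only to `x` and `y`. -/
def unfold {V : Type*} (G : SimpleGraph V) (v : V) (X Y : Set V) :
    SimpleGraph ({w : V // w ≠ v} ⊕ UnfoldVertex) :=
  SimpleGraph.fromRel (G.unfoldRel v X Y)

section Decidability

variable {V : Type*} (G : SimpleGraph V) [DecidableRel G.Adj] (v : V)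
  (X Y : Set V) [DecidablePred (· ∈ X)] [DecidablePred (· ∈ Y)]

instance : DecidableRel (G.unfoldRel v X Y)
  | .inl s, .inl t => inferInstanceAs (Decidable (G.Adj s t))
  | .inl _, .inr _ => inferInstanceAs (Decidable False)
  | .inr .x, .inl t => inferInstanceAs (Decidable (t.1 ∈ X))
  | .inr .y, .inl t => inferInstanceAs (Decidable (t.1 ∈ Y))
  | .inr .z, .inl _ => inferInstanceAs (Decidable False)
  | .inr .x, .inr _ => inferInstanceAs (Decidable False)
  | .inr .y, .inr _ => inferInstanceAs (Decidable False)
  | .inr .z, .inr q => inferInstanceAs (Decidable (q = .x ∨ q = .y))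

instance [DecidableEq V] : DecidableRel (G.unfold v X Y).Adj := fun p q =>
  decidable_of_iff _ (SimpleGraph.fromRel_adj (G.unfoldRel v X Y) p q).symm

end Decidability

end SimpleGraph

/-! ### The graph `S₃` -/

/-- The vertices of `S₃`. -/
inductive S3Vertex
  | a | b | c | d | e | v
  deriving DecidableEq

instance : Fintype S3Vertex := ⟨{.a, .b, .c, .d, .e, .v}, fun p => by cases p <;> simp⟩

/-- The graph `S₃`: the triangle `b c v` together with vertices `a`, `d`, `e` adjacent to the ends of
`b c`, of `b v` and of `c v`, respectively. -/
def graphS3 : SimpleGraph S3Vertex :=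
  SimpleGraph.fromRel fun p q => (p, q) ∈
    ([(.b, .c), (.b, .v), (.c, .v), (.a, .b), (.a, .c), (.d, .b), (.d, .v), (.e, .c), (.e, .v)] :
      List (S3Vertex × S3Vertex))

instance : DecidableRel graphS3.Adj := fun p q =>
  decidable_of_iff _ (SimpleGraph.fromRel_adj _ p q).symm

/-- The set `X = {b, c, e}` used to unfold `v` in `S₃`. -/
def unfoldX : Finset S3Vertex := {.b, .c, .e}

/-- The set `Y = {b, c, d}` used to unfold `v` in `S₃`. -/
def unfoldY : Finset S3Vertex := {.b, .c, .d}

/-- The graph obtained from `S₃` by unfolding `v` with respect to `X = {b, c, e}` and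
`Y = {b, c, d}`. -/
abbrev unfoldedS3 : SimpleGraph ({w : S3Vertex // w ≠ .v} ⊕ SimpleGraph.UnfoldVertex) :=
  graphS3.unfold .v (unfoldX : Set S3Vertex) (unfoldY : Set S3Vertex)

/-! The five cliques `abc`, `bdy`, `cex`, `xz`, `yz` trace an odd cycle `b c x z y` on the remaining
vertices once `a`, `d`, `e` are fixed at 1/2 by the box. Weight 1/2 on each is dual optimal for the
all-ones objective on the cycle. An integral optimum would use only tight rows, each of even sum on
the cycle, yet must total 5: `not_isTDI_of_odd`.

Perfection: the graph is 3-colorable, and deleting any transversal of its five triangles leaves a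
bipartite graph.

A member of `ℛ` has a square submatrix with determinant outside {0, 1, -1}. In order at most 3 this
forces a 3-sun (`exists_sun_of_det`), impossible here because every triangle has an edge lying in no
other triangle (`not_sun`). With only eight vertices, larger order means a 4 + 4 bipartition of the
whole graph; the unique independent 4-set determines it, and the matrix is singular (`det_eq_zero`).
-/

namespace LinearSystem

/-! ### A parity obstruction to total dual integrality -/

variable {I J : Type*} [Fintype I]

/-- The last sum is the duality gap. It yields both weak duality and complementary slackness below.
-/
theorem IsDualFeasible.dualValue_eq [Fintype J] {A : Matrix I J ℚ} {w : J → ℤ} {y : I → ℝ}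
    (hy : IsDualFeasible A w y) (b : I → ℚ) (x : J → ℚ) :
    dualValue b y = ∑ j, (w j : ℝ) * x j + ∑ i, y i * ((b i - ∑ j, A i j * x j : ℚ) : ℝ) := by
  have h : ∑ j, (w j : ℝ) * x j = ∑ i, y i * ((∑ j, A i j * x j : ℚ) : ℝ) := by
    simp only [← hy.2, Finset.sum_mul, Rat.cast_sum, Finset.mul_sum]
    rw [Finset.sum_comm]
    refine Finset.sum_congr rfl fun i _ => Finset.sum_congr rfl fun j _ => ?_
    push_cast
    ring
  rw [h, ← Finset.sum_add_distrib, dualValue]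
  refine Finset.sum_congr rfl fun i _ => ?_
  push_cast
  ring

/-- A system is not totally dual integral if it has complementary primal and dual solutions `x`,
`y` for some `w`, and some odd entry sum of `w` over a set `S` of columns, although every row tight
at `x` has an even entry sum over `S`. -/
theorem not_isTDI_of_odd [Fintype J] {A : Matrix I J ℚ} {b : I → ℚ} (w : J → ℤ)
    (x : J → ℚ) (hx : ∀ i, ∑ j, A i j * x j ≤ b i)
    (y : I → ℚ) (hy0 : ∀ i, 0 ≤ y i) (hy : ∀ j, ∑ i, A i j * y i = w j)
    (hxy : ∀ i, y i ≠ 0 → ∑ j, A i j * x j = b i)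
    (S : Finset J) (hS : Odd (∑ j ∈ S, w j))
    (hA : ∀ i, ∑ j, A i j * x j = b i → ∃ k : ℤ, ∑ j ∈ S, A i j = 2 * k) :
    ¬ IsTDI A b := by
  intro h
  have hyfeas : IsDualFeasible A w (fun i => (y i : ℝ)) :=
    ⟨fun i => Rat.cast_nonneg.2 (hy0 i), fun j => by
      have := congrArg (Rat.cast : ℚ → ℝ) (hy j)
      push_cast at this
      exact this⟩
  have hslack : ∀ i, (0 : ℝ) ≤ ((b i - ∑ j, A i j * x j : ℚ) : ℝ) := fun i => by
    exact_mod_cast sub_nonneg.2 (hx i)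
  obtain ⟨t, ht, hopt⟩ := h w ⟨_, hyfeas⟩ ⟨∑ j, (w j : ℝ) * x j, by
    rintro _ ⟨y', hy', rfl⟩
    rw [hy'.dualValue_eq b x]
    exact le_add_of_nonneg_right
      (Finset.sum_nonneg fun i _ => mul_nonneg (hy'.1 i) (hslack i))⟩
  have hle := hopt _ hyfeas
  rw [ht.dualValue_eq b x, hyfeas.dualValue_eq b x] at hle
  have hzero : ∑ i, (y i : ℝ) * ((b i - ∑ j, A i j * x j : ℚ) : ℝ) = 0 := by
    refine Finset.sum_eq_zero fun i _ => ?_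
    by_cases hi : y i = 0
    · simp [hi]
    · rw [hxy i hi]; simp
  have hnn : ∀ i ∈ Finset.univ, 0 ≤ (t i : ℝ) * ((b i - ∑ j, A i j * x j : ℚ) : ℝ) :=
    fun i _ => mul_nonneg (ht.1 i) (hslack i)
  -- The optimum equals `wᵀ x`, so the gap of `t` vanishes term by term: `t` is supported on rows
  -- tight at `x`.
  have hcs := (Finset.sum_eq_zero_iff_of_nonneg hnn).1
    (le_antisymm (by linarith) (Finset.sum_nonneg hnn))
  have hterm : ∀ i, ∃ k : ℤ, ((∑ j ∈ S, A i j : ℚ) : ℝ) * t i = 2 * k := fun i => by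
    rcases mul_eq_zero.1 (hcs i (Finset.mem_univ i)) with h0 | h0
    · exact ⟨0, by simp [h0]⟩
    · have h0' : b i - ∑ j, A i j * x j = 0 := by exact_mod_cast h0
      obtain ⟨k, hk⟩ := hA i (by linarith)
      exact ⟨k * t i, by rw [hk]; push_cast; ring⟩
  choose k hk using hterm
  have hsum : ((∑ j ∈ S, w j : ℤ) : ℝ) = ((2 * ∑ i, k i : ℤ) : ℝ) := by
    push_cast
    simp only [← ht.2, Finset.mul_sum, ← hk]
    rw [Finset.sum_comm]
    refine Finset.sum_congr rfl fun i _ => ?_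
    rw [Rat.cast_sum, Finset.sum_mul]
  rw [Int.cast_inj.1 hsum] at hS
  exact Int.not_odd_iff_even.2 (even_two_mul _) hS

end LinearSystem

namespace UnfoldedS3

set_option maxRecDepth 100000
set_option synthInstance.maxHeartbeats 400000
set_option synthInstance.maxSize 2000

/-- The vertex type of `unfoldedS3`. -/
abbrev Vert := {w : S3Vertex // w ≠ .v} ⊕ SimpleGraph.UnfoldVertex

abbrev a : Vert := .inl ⟨.a, by decide⟩
abbrev b : Vert := .inl ⟨.b, by decide⟩
abbrev c : Vert := .inl ⟨.c, by decide⟩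
abbrev d : Vert := .inl ⟨.d, by decide⟩
abbrev e : Vert := .inl ⟨.e, by decide⟩
abbrev x : Vert := .inr .x
abbrev y : Vert := .inr .y
abbrev z : Vert := .inr .z

/-! ### `unfoldedS3` is not box-perfect -/

/-- An optimal point of the clique system with boxes `lowerBound`, `upperBound`. -/
def primal (p : Vert) : ℚ :=
  if p = z then 3 / 4 else if p ∈ ({a, d, e} : Finset Vert) then 1 / 2 else 1 / 4

/-- Together with `upperBound`, this fixes `a`, `d`, `e` at 1/2; at the other vertices `primal` is
strictly inside the box, so no bound is tight there. -/
def lowerBound (p : Vert) : ℚ := if p ∈ ({a, d, e} : Finset Vert) then 1 / 2 else 0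

def upperBound (p : Vert) : ℚ := if p ∈ ({a, d, e} : Finset Vert) then 1 / 2 else 1

def objective (p : Vert) : ℤ := if p ∈ ({a, d, e} : Finset Vert) then 0 else 1

/-- The cliques that are tight at `primal`. -/
def tightCliques : Finset (Finset Vert) :=
  {{a, b, c}, {b, d, y}, {c, e, x}, {x, z}, {y, z}}

/-- Each cycle vertex lies in two of the tight cliques and so receives weight 1. The lower-bound
rows cancel the 1/2 received by each of `a`, `d`, `e`. -/
def dual : ({C : Finset Vert // unfoldedS3.IsClique C} ⊕ Vert) ⊕ (Vert ⊕ Vert) → ℚ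
  | .inl (.inl C) => if C.1 ∈ tightCliques then 1 / 2 else 0
  | .inl (.inr _) => 0
  | .inr (.inl _) => 0
  | .inr (.inr p) => if p ∈ ({a, d, e} : Finset Vert) then 1 / 2 else 0

theorem not_isBoxPerfect : ¬ unfoldedS3.IsBoxPerfect := by
  intro h
  refine LinearSystem.not_isTDI_of_odd objective primal ?_ dual ?_ ?_ ?_ {b, c, x, y, z} ?_ ?_
    (h lowerBound upperBound)
  · decide +kernel
  · decide +kernel
  · decide +kernel
  · decide +kernel
  · decide +kernel
  -- A tight clique meets the 5-cycle in two vertices; a tight bound concerns `a`, `d` or `e` and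
  -- contributes 0. Naming these two values makes the claim decidable.
  · have key : ∀ i, ∑ j, Matrix.fromRows unfoldedS3.cliqueSystemMatrix
          (Matrix.fromRows (1 : Matrix Vert Vert ℚ) (-1 : Matrix Vert Vert ℚ)) i j * primal j =
        Sum.elim unfoldedS3.cliqueSystemRhs (Sum.elim upperBound (-lowerBound)) i →
        ∑ j ∈ {b, c, x, y, z}, Matrix.fromRows unfoldedS3.cliqueSystemMatrix
          (Matrix.fromRows (1 : Matrix Vert Vert ℚ) (-1 : Matrix Vert Vert ℚ)) i j = 2 * (0 : ℤ) ∨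
        ∑ j ∈ {b, c, x, y, z}, Matrix.fromRows unfoldedS3.cliqueSystemMatrix
          (Matrix.fromRows (1 : Matrix Vert Vert ℚ) (-1 : Matrix Vert Vert ℚ)) i j
            = 2 * (1 : ℤ) := by
      decide +kernel
    intro i hi
    rcases key i hi with h | h
    exacts [⟨0, h⟩, ⟨1, h⟩]

end UnfoldedS3

/-! ### Perfection of 3-colorable graphs -/

namespace SimpleGraph

theorem chromaticNumber_eq_cliqueNum_of_isClique {V : Type*} [Finite V] {G : SimpleGraph V}
    (t : Finset V) (ht : G.IsClique t) (h : G.Colorable t.card) :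
    G.chromaticNumber = (G.cliqueNum : ℕ∞) := by
  refine le_antisymm (h.chromaticNumber_le.trans ?_) G.cliqueNum_le_chromaticNumber
  exact_mod_cast ht.card_le_cliqueNum

/-- A graph is perfect if it is 3-colorable and all its triangle-free induced subgraphs are
2-colorable. -/
theorem isPerfect_of_colorable {V : Type*} [Finite V] {G : SimpleGraph V} (h3 : G.Colorable 3)
    (h2 : ∀ s : Set V, (G.induce s).CliqueFree 3 → (G.induce s).Colorable 2) : G.IsPerfect := by
  classical
  intro s
  by_cases htri : (G.induce s).CliqueFree 3
  · by_cases hedge : ∃ p q, (G.induce s).Adj p q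
    · obtain ⟨p, q, hpq⟩ := hedge
      refine chromaticNumber_eq_cliqueNum_of_isClique {p, q} ?_ ?_
      · simpa using fun _ => hpq
      · rw [Finset.card_pair hpq.ne]
        exact h2 s htri
    · push Not at hedge
      rcases isEmpty_or_nonempty s with hs | ⟨⟨p⟩⟩
      · refine chromaticNumber_eq_cliqueNum_of_isClique ∅ (by simp) ?_
        exact ⟨Coloring.mk (fun p => hs.elim p) fun {p} => hs.elim p⟩
      · refine chromaticNumber_eq_cliqueNum_of_isClique {p} (by simp) ?_
        rw [Finset.card_singleton]
        exact ⟨Coloring.mk (fun _ => 0) fun {q r} hqr => (hedge q r hqr).elim⟩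
  · rw [CliqueFree] at htri
    push Not at htri
    obtain ⟨t, ht⟩ := htri
    refine chromaticNumber_eq_cliqueNum_of_isClique t ht.isClique ?_
    rw [ht.card_eq]
    exact h3.of_hom (Embedding.induce s).toHom

end SimpleGraph

namespace UnfoldedS3

set_option maxRecDepth 100000
set_option synthInstance.maxHeartbeats 400000
set_option synthInstance.maxSize 2000

/-! ### `unfoldedS3` is perfect -/

def color (p : Vert) : Fin 3 :=
  if p ∈ ({b, e, z} : Finset Vert) then 0 else if p ∈ ({c, d} : Finset Vert) then 1 else 2

theorem colorable_three : unfoldedS3.Colorable 3 :=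
  ⟨SimpleGraph.Coloring.mk color fun {p q} => by
    have : ∀ p q, unfoldedS3.Adj p q → color p ≠ color q := by decide +kernel
    exact this p q⟩

theorem colorable_two_of_disjoint {s : Set Vert} (A T : Finset Vert) (hT : ∀ p ∈ T, p ∉ s)
    (hA : ∀ p q, p ∉ T → q ∉ T → unfoldedS3.Adj p q → decide (p ∈ A) ≠ decide (q ∈ A)) :
    (unfoldedS3.induce s).Colorable 2 :=
  (SimpleGraph.Coloring.mk (fun p : s => decide (p.1 ∈ A)) fun {p q} hpq =>
    hA p q (fun h => hT _ h p.2) (fun h => hT _ h q.2) hpq).colorable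

theorem colorable_two_of_cliqueFree (s : Set Vert) (hs : (unfoldedS3.induce s).CliqueFree 3) :
    (unfoldedS3.induce s).Colorable 2 := by
  classical
  have htri : ∀ p q r, unfoldedS3.Adj p q → unfoldedS3.Adj p r → unfoldedS3.Adj q r →
      p ∈ s → q ∈ s → r ∉ s := fun p q r hpq hpr hqr hp hq hr =>
    hs {⟨p, hp⟩, ⟨q, hq⟩, ⟨r, hr⟩} <| SimpleGraph.is3Clique_triple_iff.2
      ⟨SimpleGraph.induce_adj.2 hpq, SimpleGraph.induce_adj.2 hpr, SimpleGraph.induce_adj.2 hqr⟩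
  have habc := htri a b c (by decide) (by decide) (by decide)
  have hbcx := htri b c x (by decide) (by decide) (by decide)
  have hbcy := htri b c y (by decide) (by decide) (by decide)
  have hbdy := htri b d y (by decide) (by decide) (by decide)
  have hcex := htri c e x (by decide) (by decide) (by decide)
  -- These are the minimal transversals of the five triangles.
  have hcases : (b ∉ s ∧ c ∉ s) ∨ (b ∉ s ∧ e ∉ s) ∨ (b ∉ s ∧ x ∉ s) ∨ (c ∉ s ∧ d ∉ s) ∨
      (c ∉ s ∧ y ∉ s) ∨ (a ∉ s ∧ x ∉ s ∧ y ∉ s) := by tauto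
  rcases hcases with h | h | h | h | h | h
  · exact colorable_two_of_disjoint {x, y} {b, c} (by simpa using h) (by decide +kernel)
  · exact colorable_two_of_disjoint {c, d, z} {b, e} (by simpa using h) (by decide +kernel)
  · exact colorable_two_of_disjoint {c, d, z} {b, x} (by simpa using h) (by decide +kernel)
  · exact colorable_two_of_disjoint {b, e, z} {c, d} (by simpa using h) (by decide +kernel)
  · exact colorable_two_of_disjoint {b, e, z} {c, y} (by simpa using h) (by decide +kernel)
  · exact colorable_two_of_disjoint {b, e} {a, x, y} (by simpa using h) (by decide +kernel)

theorem isPerfect : unfoldedS3.IsPerfect :=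
  SimpleGraph.isPerfect_of_colorable colorable_three colorable_two_of_cliqueFree

end UnfoldedS3

/-! ### `unfoldedS3` contains no member of `ℛ` -/

/-- Up to the order of rows, the only such 0/1 matrix is the 3 by 3 all-ones matrix minus the
identity, of determinant ±2; orders below 3 give none. -/
theorem Matrix.exists_triangle_of_det {k : ℕ} (hk : k ≤ 3) (M : Fin k → Fin k → Bool)
    (h : (Matrix.of fun i j => if M i j then (1 : ℤ) else 0).det ∉ Set.range SignType.cast) :
    ∃ g : Fin 3 → Fin k, g.Injective ∧ ∀ j, ∃ i, ∀ l, M i (g l) = decide (l ≠ j) := by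
  have h' : ∀ s : SignType, (s : ℤ) ≠ (Matrix.of fun i j => if M i j then (1 : ℤ) else 0).det :=
    fun s hs => h ⟨s, hs⟩
  clear h
  interval_cases k
  · exact absurd (by simp) (h' 1)
  · revert M; decide +kernel
  · revert M; decide +kernel
  · refine ⟨id, Function.injective_id, ?_⟩
    revert M; decide +kernel

namespace SimpleGraph

variable {U V : Type*} {B : SimpleGraph (U ⊕ V)} {F : SimpleGraph V}

theorem addRightEdges_adj_inl_inr {u : U} {v : V} :
    (B.addRightEdges F).Adj (.inl u) (.inr v) ↔ B.Adj (.inl u) (.inr v) := by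
  simp [addRightEdges, SimpleGraph.map_adj']

theorem not_addRightEdges_adj_inl_inl
    (hB : B.IsBipartiteWith (Set.range Sum.inl) (Set.range Sum.inr)) (u u' : U) :
    ¬ (B.addRightEdges F).Adj (.inl u) (.inl u') := by
  intro h
  have h' : B.Adj (.inl u) (.inl u') := by
    simpa [addRightEdges, SimpleGraph.map_adj'] using h
  simpa using hB.mem_of_adj h'

/-- A square submatrix of order at most 3 of the biadjacency matrix with determinant outside
`{0, 1, -1}` yields a triangle in which every edge has a common neighbor not adjacent to the
third vertex. -/
theorem exists_sun_of_det
    (hcl : ∀ u, (B.addRightEdges F).IsClique ((B.addRightEdges F).neighborSet (Sum.inl u)))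
    {k : ℕ} (hk : k ≤ 3) (f : Fin k → U) {g : Fin k → V} (hg : g.Injective)
    (h : (B.biadjMatrix.submatrix f g).det ∉ Set.range SignType.cast) :
    ∃ (u : Fin 3 → U) (v : Fin 3 → V),
      (∀ j l, (B.addRightEdges F).Adj (.inl (u j)) (.inr (v l)) ↔ l ≠ j) ∧
      ∀ j l, j ≠ l → (B.addRightEdges F).Adj (.inr (v j)) (.inr (v l)) := by
  classical
  have hM : B.biadjMatrix.submatrix f g = Matrix.of fun i j =>
      if decide (B.Adj (.inl (f i)) (.inr (g j))) then (1 : ℤ) else 0 := by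
    ext i j
    simp [biadjMatrix]
  rw [hM] at h
  obtain ⟨g', hg', hrow⟩ := Matrix.exists_triangle_of_det hk _ h
  choose r hr using hrow
  have hadj : ∀ j l, (B.addRightEdges F).Adj (.inl (f (r j))) (.inr (g (g' l))) ↔ l ≠ j :=
    fun j l => by
      rw [addRightEdges_adj_inl_inr]
      simpa using Bool.eq_iff_iff.1 (hr j l)
  refine ⟨fun j => f (r j), fun l => g (g' l), hadj, fun j l hjl => ?_⟩
  obtain ⟨t, htj, htl⟩ : ∃ t : Fin 3, j ≠ t ∧ l ≠ t := by
    revert j l; decide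
  exact hcl (f (r t)) ((hadj t j).2 htj) ((hadj t l).2 htl)
    fun h => hjl (hg' (hg (Sum.inr_injective h)))

end SimpleGraph

namespace UnfoldedS3

set_option maxRecDepth 100000
set_option synthInstance.maxHeartbeats 400000
set_option synthInstance.maxSize 2000

/-- There is no `K₄`, so this says that each triangle has an edge in no other triangle. -/
theorem exists_edge_of_triangle : ∀ p q r : Vert,
    unfoldedS3.Adj p q → unfoldedS3.Adj p r → unfoldedS3.Adj q r →
    (∀ w, unfoldedS3.Adj w q → unfoldedS3.Adj w r → w ≠ p → unfoldedS3.Adj w p) ∨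
    (∀ w, unfoldedS3.Adj w p → unfoldedS3.Adj w r → w ≠ q → unfoldedS3.Adj w q) ∨
    (∀ w, unfoldedS3.Adj w p → unfoldedS3.Adj w q → w ≠ r → unfoldedS3.Adj w r) := by
  decide +kernel

/-- The set `S` allows for the deleted vertex in the first case of the definition of `ℛ`. -/
theorem not_sun {W : Type*} {K : SimpleGraph W} {S : Set W} (ψ : K.induce S ↪g unfoldedS3)
    (u v : Fin 3 → W) (hu : ∀ j, u j ∈ S) (hv : ∀ j, v j ∈ S)
    (huv : ∀ j l, K.Adj (u j) (v l) ↔ l ≠ j) (hne : ∀ j, u j ≠ v j)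
    (hvv : ∀ j l, j ≠ l → K.Adj (v j) (v l)) : False := by
  have huv' : ∀ j l, unfoldedS3.Adj (ψ ⟨u j, hu j⟩) (ψ ⟨v l, hv l⟩) ↔ l ≠ j := fun j l =>
    ψ.map_adj_iff.trans (huv j l)
  have hne' : ∀ j, ψ ⟨u j, hu j⟩ ≠ ψ ⟨v j, hv j⟩ := fun j h =>
    hne j (congrArg Subtype.val (ψ.injective h))
  have hvv' : ∀ j l, j ≠ l → unfoldedS3.Adj (ψ ⟨v j, hv j⟩) (ψ ⟨v l, hv l⟩) := fun j l h =>
    ψ.map_adj_iff.2 (hvv j l h)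
  rcases exists_edge_of_triangle _ _ _ (hvv' 0 1 (by decide)) (hvv' 0 2 (by decide))
    (hvv' 1 2 (by decide)) with h | h | h
  · exact (huv' 0 0).1 (h _ ((huv' 0 1).2 (by decide)) ((huv' 0 2).2 (by decide)) (hne' 0)) rfl
  · exact (huv' 1 1).1 (h _ ((huv' 1 0).2 (by decide)) ((huv' 1 2).2 (by decide)) (hne' 1)) rfl
  · exact (huv' 2 2).1 (h _ ((huv' 2 0).2 (by decide)) ((huv' 2 1).2 (by decide)) (hne' 2)) rfl

/-- In fact `{a, d, e, z}` is the only independent set of size 4. -/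
theorem eq_of_indep_four : ∀ p q r t : Vert,
    p ≠ q → p ≠ r → p ≠ t → q ≠ r → q ≠ t → r ≠ t →
    ¬ unfoldedS3.Adj p q → ¬ unfoldedS3.Adj p r → ¬ unfoldedS3.Adj p t →
    ¬ unfoldedS3.Adj q r → ¬ unfoldedS3.Adj q t → ¬ unfoldedS3.Adj r t →
    p ∈ ({a, d, e, z} : Finset Vert) := by
  decide +kernel

theorem mem_of_indep {m : ℕ} (hm : 4 ≤ m) {φ : Fin m → Vert} (hφ : φ.Injective)
    (h : ∀ i j, ¬ unfoldedS3.Adj (φ i) (φ j)) (i : Fin m) :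
    φ i ∈ ({a, d, e, z} : Finset Vert) := by
  obtain ⟨t, ht, htc⟩ := Finset.exists_subset_card_eq
    (s := (Finset.univ.erase i : Finset (Fin m))) (n := 3) (by simp; omega)
  obtain ⟨q, r, s, hqr, hqs, hrs, rfl⟩ := Finset.card_eq_three.1 htc
  have hq : q ≠ i := by simpa using ht (show q ∈ _ by simp)
  have hr : r ≠ i := by simpa using ht (show r ∈ _ by simp)
  have hs : s ≠ i := by simpa using ht (show s ∈ _ by simp)
  exact eq_of_indep_four (φ i) (φ q) (φ r) (φ s) (hφ.ne hq.symm) (hφ.ne hr.symm) (hφ.ne hs.symm)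
    (hφ.ne hqr) (hφ.ne hqs) (hφ.ne hrs) (h _ _) (h _ _) (h _ _) (h _ _) (h _ _) (h _ _)

/-- A vector in the kernel of the adjacency matrix between `{a, d, e, z}` and `{b, c, x, y}`. -/
def kernelVector (p : Vert) : ℤ :=
  if p ∈ ({b, x} : Finset Vert) then 1 else if p ∈ ({c, y} : Finset Vert) then -1 else 0

theorem sum_kernelVector : ∀ p ∈ ({a, d, e, z} : Finset Vert),
    ∑ w, (if unfoldedS3.Adj p w then 1 else 0) * kernelVector w = 0 := by
  decide +kernel

/-- Biadjacency matrices of spanning bipartitions of `unfoldedS3` of order 4 are singular. -/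
theorem det_eq_zero {m n : ℕ} {B : SimpleGraph (Fin m ⊕ Fin n)} {F : SimpleGraph (Fin n)}
    (hB : B.IsBipartiteWith (Set.range Sum.inl) (Set.range Sum.inr))
    (φ : B.addRightEdges F ↪g unfoldedS3) (hm : m = 4) (hn : n = 4)
    (f : Fin 4 → Fin m) {g : Fin 4 → Fin n} (hg : g.Injective) :
    (B.biadjMatrix.submatrix f g).det = 0 := by
  classical
  have hφ : Function.Bijective φ := by
    rw [Fintype.bijective_iff_injective_and_card]
    refine ⟨φ.injective, ?_⟩
    rw [Fintype.card_sum, Fintype.card_fin, Fintype.card_fin, hm, hn]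
    decide +kernel
  have hg' : Function.Bijective g := by
    rw [Fintype.bijective_iff_injective_and_card]
    exact ⟨hg, by simp [hn]⟩
  have hU : ∀ u, φ (.inl u) ∈ ({a, d, e, z} : Finset Vert) :=
    mem_of_indep hm.ge (φ := fun u => φ (.inl u)) (φ.injective.comp Sum.inl_injective)
      fun i j h => SimpleGraph.not_addRightEdges_adj_inl_inl hB i j (φ.map_adj_iff.1 h)
  rw [← Matrix.exists_mulVec_eq_zero_iff]
  refine ⟨fun j => kernelVector (φ (.inr (g j))), fun h0 => ?_, ?_⟩
  -- The vector is nonzero since `b` is outside `{a, d, e, z}`, hence the image of a column.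
  · obtain ⟨p | v, hp⟩ := hφ.2 b
    · exact absurd (hp ▸ hU p) (by decide +kernel)
    · obtain ⟨j, rfl⟩ := hg'.2 v
      have := congrFun h0 j
      simp only [hp] at this
      exact absurd this (by decide +kernel : kernelVector b ≠ 0)
  · ext i
    have key := sum_kernelVector _ (hU (f i))
    rw [← hφ.sum_comp, Fintype.sum_sum_type] at key
    simp only [φ.map_adj_iff, SimpleGraph.not_addRightEdges_adj_inl_inl hB,
      SimpleGraph.addRightEdges_adj_inl_inr, if_false, zero_mul, Finset.sum_const_zero,
      zero_add] at key
    rw [← hg'.sum_comp] at key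
    simpa [Matrix.mulVec, dotProduct, SimpleGraph.biadjMatrix] using key

theorem not_hasInducedR : ¬ unfoldedS3.HasInducedR := by
  rintro ⟨s, m, n, B, F, hB, ⟨hTU, -⟩, hcl, hH⟩
  rw [Matrix.IsTotallyUnimodular] at hTU
  push Not at hTU
  obtain ⟨k, f, g, hf, hg, hdet⟩ := hTU
  have hkm : k ≤ m := by simpa using Fintype.card_le_of_injective f hf
  have hkn : k ≤ n := by simpa using Fintype.card_le_of_injective g hg
  rcases hH with ⟨u₀, hu₀, ⟨e⟩⟩ | ⟨-, ⟨e⟩⟩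
  · have ψ := (SimpleGraph.Embedding.induce (G := unfoldedS3) s).comp e.symm.toEmbedding
    -- Here `V` is the neighborhood of `u₀`, hence a clique, and it survives the deletion of `u₀`.
    have hn : n ≤ 3 := by
      by_contra! hn
      refine SimpleGraph.IsContained.not_cliqueFree (n := n)
        ⟨ψ.toHom.comp ⟨fun v => ⟨.inr v, by simp⟩, fun {v w} hvw => ?_⟩, fun v w h => ?_⟩
        ((colorable_three.cliqueFree (by norm_num : 3 < 4)).mono hn)
      · exact hcl u₀ (hu₀ ▸ ⟨v, rfl⟩) (hu₀ ▸ ⟨w, rfl⟩) (Sum.inr_injective.ne hvw)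
      · exact Sum.inr_injective (congrArg Subtype.val (ψ.injective h))
    obtain ⟨u, v, huv, hvv⟩ :=
      SimpleGraph.exists_sun_of_det hcl (hkn.trans hn) f hg hdet
    refine not_sun ψ (fun j => .inl (u j)) (fun j => .inr (v j)) (fun j hj => ?_)
      (fun j => by simp) huv (fun j => by simp) hvv
    -- The deleted vertex cannot be in the sun: it is adjacent to all of `V`, whereas `u j` misses
    -- `v j`.
    have hadj : (B.addRightEdges F).Adj (.inl (u j)) (.inr (v j)) := by
      rw [Set.mem_singleton_iff] at hj
      rw [hj, ← SimpleGraph.mem_neighborSet, hu₀]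
      exact ⟨_, rfl⟩
    exact (huv j j).1 hadj rfl
  · have φ := (SimpleGraph.Embedding.induce (G := unfoldedS3) s).comp e.symm.toEmbedding
    have hcard : m + n ≤ 8 := by
      have h8 : Fintype.card Vert = 8 := by decide +kernel
      have := Fintype.card_le_of_injective φ φ.injective
      rwa [Fintype.card_sum, Fintype.card_fin, Fintype.card_fin, h8] at this
    rcases Nat.lt_or_ge 3 k with hk | hk
    -- From `k ≤ m`, `k ≤ n` and `m + n ≤ 8`, which also force `m = n = 4`.
    · obtain rfl : k = 4 := by omega
      refine hdet ⟨0, ?_⟩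
      rw [det_eq_zero hB φ (by omega) (by omega) f hg]
      rfl
    · obtain ⟨u, v, huv, hvv⟩ := SimpleGraph.exists_sun_of_det hcl hk f hg hdet
      exact not_sun (φ.comp (SimpleGraph.Embedding.induce Set.univ)) (fun j => .inl (u j))
        (fun j => .inr (v j)) (fun _ => trivial) (fun _ => trivial) huv (fun j => by simp) hvv

end UnfoldedS3

theorem proposition5p6 :
    graphS3.CanUnfold .v (unfoldX : Set S3Vertex) (unfoldY : Set S3Vertex) ∧
    unfoldedS3.IsPerfect ∧
    ¬ unfoldedS3.IsBoxPerfect ∧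
    ¬ unfoldedS3.HasInducedR ∧
    -- consequently, the Ding-Zang-Zhao conjecture fails
    ¬ (∀ (V : Type) [Fintype V] [DecidableEq V] (G : SimpleGraph V) [DecidableRel G.Adj],
        G.IsPerfect → (G.IsBoxPerfect ↔ ¬ G.HasInducedR)) := by
  refine ⟨⟨?_, by decide +kernel⟩, UnfoldedS3.isPerfect, UnfoldedS3.not_isBoxPerfect,
    UnfoldedS3.not_hasInducedR, fun h => UnfoldedS3.not_isBoxPerfect
      ((h _ unfoldedS3 UnfoldedS3.isPerfect).2 UnfoldedS3.not_hasInducedR)⟩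
  ext p
  have : ∀ p, (p ∈ unfoldX ∨ p ∈ unfoldY) ↔ graphS3.Adj .v p := by decide +kernel
  simpa using this p
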